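/- Consider the deterministic Congested Clique model: $n$ nodes with identifiers $1,\dots,n$ communicate in synchronous rounds, in each of which every node may send a message of $O(\log n)$ bits to every other node; local computation is unrestricted. Let $G=(V,E)$ be a simple weighted directed graph on these $n$ nodes whose edge weights are positive integers bounded by a polynomial in $n$. Write $d_G(u,v)\in\mathbb{N}\cup\{\infty\}$ for the minimum length of a directed path from $u$ to $v$, and let $d$ be the weighted diameter of $G$, i.e. the maximum of $d_G(u,v)$ over all pairs $u,v$ such that $v$ is reachable from $u$ (all pairs, if $G$ is strongly connected). Let $a\ge 1$ and let $\delta$ be an $a$-approximation of APSP on $G$, that is, $d_G(u,v)\le\delta(u,v)\le a\cdot d_G(u,v)$ for all $u,v\in V$. Initially each node $u$ knows the edges of $G$ incident to it, with their weights, and the values $\delta(u,v)$ for all $v\in V$. For an integer $k\ge 0$ let $N_k(u)$ be the set of the $k$ nodes $v$ with the smallest values of $d_G(u,v)$, ties broken by identifiers. A weighted directed graph $H$ on $V$ is a $k$-nearest $\beta$-hopset for $G$ if $d_{G\cup H}(u,v)=d_G(u,v)$ for all $u,v\in V$, and for all $u\in V$ and all $v\in N_k(u)$ with $d_G(u,v)<\infty$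 there is a path in $G\cup H$ from $u$ to $v$ with at most $\beta$ edges and length exactly $d_G(u,v)$. Then there is a deterministic algorithm, which needs to know neither $a$ nor $d$, that computes in $O(1)$ rounds a $\lceil\sqrt n\rceil$-nearest $\beta$-hopset $H$ for $G$ with $\beta\in O(a\log d+1)$ (so $\beta\in O(a\log d)$ if $d\ge 2$); at the end every node knows the edges of $H$ incident to it, with their weights. The number of rounds and the constant in the bound on $\beta$ are absolute, and the constant in the message size depends only on the exponent of the polynomial that bounds the weights. -/

import Mathlib

open scoped ENNReal

/-- A simple directed graph on `V` with positive integer edge weights: `w u v` is the weight of the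
edge from `u` to `v`, and `w u v = ⊤` means that there is no such edge. -/
structure WDigraph (V : Type) where
  w : V → V → ℕ∞
  loopless : ∀ v, w v v = ⊤
  pos : ∀ u v, 0 < w u v

namespace WDigraph

variable {V : Type}

/-- The union of two weighted digraphs; of two parallel edges the lighter one is kept. -/
noncomputable def union (G H : WDigraph V) : WDigraph V where
  w u v := min (G.w u v) (H.w u v)
  loopless v := by simp [G.loopless, H.loopless]
  pos u v := lt_min (G.pos u v) (H.pos u v)

/-- `G.IsPath u v h L`: there is a directed path (repetitions allowed) from `u` to `v` in `G` with
exactly `h` hops and length (total weight) `L`. -/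
inductive IsPath (G : WDigraph V) : V → V → ℕ → ℕ → Prop
  | nil (u : V) : IsPath G u u 0 0
  | cons {u x v : V} {ℓ h L : ℕ} (hw : G.w u x = (ℓ : ℕ∞)) (hp : IsPath G x v h L) :
      IsPath G u v (h + 1) (ℓ + L)

/-- The distance from `u` to `v`: the minimum length of a path, `⊤` if there is none. -/
noncomputable def dist (G : WDigraph V) (u v : V) : ℕ∞ :=
  sInf {x : ℕ∞ | ∃ h L : ℕ, G.IsPath u v h L ∧ x = (L : ℕ∞)}

/-- The weighted diameter: the maximum distance `G.dist u v` over all pairs for which `v` is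
reachable from `u` (`ENat.toNat ⊤ = 0`, so other pairs do not contribute). For a strongly connected
graph this is the maximum over all pairs. -/
noncomputable def weightedDiam [Fintype V] (G : WDigraph V) : ℕ :=
  Finset.univ.sup fun p : V × V => (G.dist p.1 p.2).toNat

open Classical in
/-- `N_k(v)`: the `k` nodes `u` with the smallest distances from `v`, ties broken by identifiers
(that is, by the order on `V`). -/
noncomputable def nearest [Fintype V] [LinearOrder V] (G : WDigraph V) (k : ℕ) (v : V) : Finset V :=
  Finset.univ.filter fun u =>
    (Finset.univ.filter fun x =>
      G.dist v x < G.dist v u ∨ (G.dist v x = G.dist v u ∧ x < u)).card < k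

/-- `H` is a `k`-nearest `β`-hopset for `G`. In the second condition, nodes of `N_k(u)` at infinite
distance from `u` (which occur only if fewer than `k` nodes are reachable from `u`) are exempt. -/
def IsNearestHopset [Fintype V] [LinearOrder V] (G H : WDigraph V) (k β : ℕ) : Prop :=
  (∀ u v, (G.union H).dist u v = G.dist u v) ∧
  (∀ u, ∀ v ∈ G.nearest k u, ∀ L : ℕ, G.dist u v = (L : ℕ∞) →
    ∃ h ≤ β, (G.union H).IsPath u v h L)

/-- `δ` is an `a`-approximation of all-pairs shortest paths on `G`. -/
def IsApproxAPSP (G : WDigraph V) (a : ℝ) (δ : V → V → ℝ≥0∞) : Prop :=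
  ∀ u v, ((G.dist u v : ℕ∞) : ℝ≥0∞) ≤ δ u v ∧
    δ u v ≤ ENNReal.ofReal a * ((G.dist u v : ℕ∞) : ℝ≥0∞)

end WDigraph

/-- A deterministic algorithm in the congested clique with node set `Fin n` (the identifiers), in
which every message consists of `B` bits, every node has a local input in `I` and a local output
in `O`. Local memory and local computation are unrestricted, as usual in this model. -/
structure CliqueAlg (n B : ℕ) (I O : Type) where
  State : Type
  /-- initial state of a node, given its identifier and its local input -/
  init : Fin n → I → State
  /-- `send r u s v`: the message that `u`, being in state `s`, sends to `v` in round `r` -/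
  send : ℕ → Fin n → State → Fin n → (Fin B → Bool)
  /-- `step r v s m`: the new state of `v` after round `r`, where `m u` is the message from `u` -/
  step : ℕ → Fin n → State → (Fin n → Fin B → Bool) → State
  /-- local output of a node -/
  output : Fin n → State → O

namespace CliqueAlg

variable {n B : ℕ} {I O : Type}

/-- The state of each node after `r` synchronous rounds. -/
def stateAt (A : CliqueAlg n B I O) (inp : Fin n → I) : ℕ → Fin n → A.State
  | 0, v => A.init v (inp v)
  | r + 1, v => A.step r v (A.stateAt inp r v) fun u => A.send r u (A.stateAt inp r u) v

/-- The local outputs after `R` rounds. -/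
def run (A : CliqueAlg n B I O) (R : ℕ) (inp : Fin n → I) (v : Fin n) : O :=
  A.output v (A.stateAt inp R v)

end CliqueAlg

/-- The edges incident to one node: weights of outgoing and of incoming edges. -/
structure IncidentEdges (n : ℕ) where
  outW : Fin n → ℕ∞
  inW : Fin n → ℕ∞

/-- The part of a graph that the node `v` knows: its incident edges with their weights. -/
def WDigraph.incident {n : ℕ} (G : WDigraph (Fin n)) (v : Fin n) : IncidentEdges n where
  outW u := G.w v u
  inW u := G.w u v

/-!
The hopset edges of `u` carry the distances from `u` in the graph of the edges that `u` learns: the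
`k` lightest outgoing edges of the `k` nodes that look nearest to `u` according to `δ`. Let `v` be
one of the `k` nodes nearest to `u` and follow a shortest path from `u` to `v` along known edges as
far as possible. It stops at `v` or at a node `y` whose edges `u` did not ask for, although `y` is
closer to `u` than `v` is; then `δ` ranks `y` behind some node that is at least as far from `u` as
`v`, which forces `d(u, v) ≤ a · d(u, y)`. In either case the hopset edge from `u` to `y` shrinks
the remaining distance by the factor `1 - 1 / a`, so that `a log d + 1` such edges suffice to reach
`v`.

For `k² = O(n)` the edges can be collected in constantly many rounds, because the
`k²` edges that a node asks for can be spread evenly over all nodes: node `x` is in charge of a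
constant number of pairs `(i, j)`, and answers for the edge number `i` of the `j`-th node asked.
-/

section LexRank

variable {V α α' : Type} [Fintype V] [LinearOrder V] [LinearOrder α] [LinearOrder α']
  {f : V → α} {g : V → α'} {k : ℕ} {u v : V}

/-- The position of `u`, counted from `0`, in the list of all elements of `V` sorted by `f`, where
ties are broken by the order on `V`. -/
def lexRank (f : V → α) (u : V) : ℕ :=
  (Finset.univ.filter fun x => toLex (f x, x) < toLex (f u, u)).card

theorem lexRank_lt_of_toLex_lt (h : toLex (f u, u) < toLex (f v, v)) :
    lexRank f u < lexRank f v := by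
  refine Finset.card_lt_card ((Finset.ssubset_iff_of_subset fun x hx => ?_).2 ⟨u, ?_, ?_⟩)
  · simpa using (by simpa using hx : toLex (f x, x) < toLex (f u, u)).trans h
  · simpa using h
  · simp

theorem lexRank_lt_of_lt (h : f u < f v) : lexRank f u < lexRank f v :=
  lexRank_lt_of_toLex_lt (Prod.Lex.toLex_lt_toLex.2 (Or.inl h))

theorem lexRank_injective (f : V → α) : Function.Injective (lexRank f) := fun u v huv => by
  rcases lt_trichotomy (toLex (f u, u)) (toLex (f v, v)) with h | h | h
  · exact absurd huv (lexRank_lt_of_toLex_lt h).ne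
  · exact congrArg (fun p => (ofLex p).2) h
  · exact absurd huv (lexRank_lt_of_toLex_lt h).ne'

theorem lexRank_le_of_le_strictMono {φ : α' → α} (hφ : StrictMono φ) (h : ∀ x, f x ≤ φ (g x))
    (hv : f v = φ (g v)) : lexRank g v ≤ lexRank f v := by
  refine Finset.card_le_card fun x => ?_
  simp only [Finset.mem_filter, Finset.mem_univ, true_and, Prod.Lex.toLex_lt_toLex, hv]
  rintro (hx | ⟨hx, hxv⟩)
  · exact Or.inl ((h x).trans_lt (hφ hx))
  · exact (hx ▸ h x).lt_or_eq.imp_right (⟨·, hxv⟩)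

theorem card_filter_lexRank_lt_le (f : V → α) (k : ℕ) :
    (Finset.univ.filter fun x => lexRank f x < k).card ≤ k := by
  rw [← Finset.card_range k]
  exact Finset.card_le_card_of_injOn (lexRank f) (fun x hx => by simpa using hx)
    (lexRank_injective f).injOn

theorem exists_le_lexRank_of_lexRank_lt (hf : k ≤ lexRank f u) (hg : lexRank g u < k) :
    ∃ z, k ≤ lexRank g z ∧ f z ≤ f u := by
  have hcard : ((Finset.univ.filter fun x => lexRank g x < k).erase u).card < lexRank f u :=
    (Finset.card_erase_lt_of_mem (by simpa using hg)).trans_le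
      ((card_filter_lexRank_lt_le g k).trans hf)
  obtain ⟨z, hz, hzu⟩ := Finset.exists_mem_notMem_of_card_lt_card hcard
  have hlt : toLex (f z, z) < toLex (f u, u) := by simpa using hz
  have hne : z ≠ u := by rintro rfl; exact lt_irrefl _ hlt
  refine ⟨z, by simpa [hne] using hzu, ?_⟩
  exact (Prod.Lex.toLex_lt_toLex.1 hlt).elim le_of_lt fun h => h.1.le

/-- The element of `V` at position `i` when `V` is sorted by `f`, ties broken by the order on `V`;
an arbitrary element if `i` is at least the cardinality of `V`. -/
noncomputable def atLexRank [Nonempty V] (f : V → α) (i : ℕ) : V :=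
  Function.invFun (lexRank f) i

theorem atLexRank_lexRank [Nonempty V] (f : V → α) (v : V) : atLexRank f (lexRank f v) = v :=
  Function.leftInverse_invFun (lexRank_injective f) v

end LexRank

namespace WDigraph

variable {V : Type}

section Dist

variable {G H : WDigraph V} {u v x y : V}

theorem IsPath.trans {h h' L L' : ℕ} (hp : G.IsPath u x h L) (hq : G.IsPath x v h' L') :
    G.IsPath u v (h + h') (L + L') := by
  induction hp with
  | nil => simpa using hq
  | cons hw _ ih => convert IsPath.cons hw (ih hq) using 1 <;> omega

theorem IsPath.dist_le {h L : ℕ} (hp : G.IsPath u v h L) : G.dist u v ≤ L :=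
  sInf_le ⟨h, L, hp, rfl⟩

theorem exists_isPath_of_dist_eq {L : ℕ} (hd : G.dist u v = L) : ∃ h, G.IsPath u v h L := by
  have hne : {x : ℕ∞ | ∃ h L : ℕ, G.IsPath u v h L ∧ x = (L : ℕ∞)}.Nonempty := by
    by_contra! he
    rw [dist, he, sInf_empty] at hd
    exact ENat.top_ne_natCast _ hd
  obtain ⟨h, L', hp, hL⟩ := csInf_mem hne
  obtain rfl : L = L' := by exact_mod_cast hd.symm.trans hL
  exact ⟨h, hp⟩

@[simp]
theorem dist_self (G : WDigraph V) (u : V) : G.dist u u = 0 := by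
  simpa using (IsPath.nil (G := G) u).dist_le

theorem dist_triangle (G : WDigraph V) (u x v : V) : G.dist u v ≤ G.dist u x + G.dist x v := by
  rcases hA : G.dist u x with _ | A
  · exact le_of_le_of_eq le_top (top_add _).symm
  rcases hB : G.dist x v with _ | B
  · exact le_of_le_of_eq le_top (add_top _).symm
  obtain ⟨_, hp⟩ := exists_isPath_of_dist_eq hA
  obtain ⟨_, hq⟩ := exists_isPath_of_dist_eq hB
  exact (hp.trans hq).dist_le.trans_eq (Nat.cast_add A B)

theorem dist_le_w (G : WDigraph V) (u v : V) : G.dist u v ≤ G.w u v := by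
  rcases hw : G.w u v with _ | l
  · exact le_top
  · exact (IsPath.cons hw (IsPath.nil v)).dist_le

theorem exists_w_add_dist_eq (G : WDigraph V) (huv : u ≠ v) :
    ∃ x, G.w u x + G.dist x v = G.dist u v := by
  rcases hd : G.dist u v with _ | L
  · exact ⟨u, by rw [G.loopless]; exact top_add _⟩
  obtain ⟨_, hp⟩ := exists_isPath_of_dist_eq hd
  cases hp with
  | nil => exact absurd rfl huv
  | @cons _ x _ l _ L hw hp =>
    refine ⟨x, le_antisymm ?_ ?_⟩
    · rw [hw]
      exact (add_le_add_right hp.dist_le _).trans_eq (Nat.cast_add l L).symm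
    · exact (hd.symm.trans_le (G.dist_triangle u x v)).trans (add_le_add_left (G.dist_le_w u x) _)

theorem dist_pos (G : WDigraph V) (huv : u ≠ v) : 0 < G.dist u v := by
  obtain ⟨x, hx⟩ := G.exists_w_add_dist_eq huv
  exact hx ▸ (G.pos u x).trans_le le_self_add

theorem dist_le_dist_of_forall_dist_le_w (hw : ∀ y z, G.dist y z ≤ H.w y z) (u v : V) :
    G.dist u v ≤ H.dist u v := by
  rcases hd : H.dist u v with _ | L
  · exact le_top
  obtain ⟨_, hp⟩ := exists_isPath_of_dist_eq hd
  clear hd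
  change G.dist u v ≤ (L : ℕ∞)
  induction hp with
  | nil u => simp
  | @cons u x v l _ L hl _ ih =>
    calc G.dist u v ≤ G.dist u x + G.dist x v := G.dist_triangle u x v
      _ ≤ l + L := add_le_add (hl ▸ hw u x) ih
      _ = ((l + L : ℕ) : ℕ∞) := (Nat.cast_add l L).symm

theorem dist_le_dist_of_forall_w_le_w (hw : ∀ y z, G.w y z ≤ H.w y z) (u v : V) :
    G.dist u v ≤ H.dist u v :=
  dist_le_dist_of_forall_dist_le_w (fun y z => (G.dist_le_w y z).trans (hw y z)) u v

open Classical in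
theorem dist_le_card_filter_mul [Fintype V] {W : ℕ} (hW : ∀ y z, G.w y z ≠ ⊤ → G.w y z ≤ W)
    (huv : G.dist u v ≠ ⊤) :
    G.dist u v ≤ ((Finset.univ.filter fun y => G.dist y v < G.dist u v).card * W : ℕ) := by
  induction hd : G.dist u v using WellFoundedLT.induction generalizing u with
  | ind d ih =>
  subst hd
  by_cases hne : u = v
  · simp [hne]
  obtain ⟨x, hx⟩ := G.exists_w_add_dist_eq hne
  have hw : G.w u x ≠ ⊤ := fun h => huv (by rw [← hx, h, top_add])
  have hxv : G.dist x v ≠ ⊤ := fun h => huv (by rw [← hx, h, add_top])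
  have hlt : G.dist x v < G.dist u v := by
    rw [← hx]
    exact ENat.lt_add_left hxv (G.pos u x)
  have hcard : (Finset.univ.filter fun y => G.dist y v < G.dist x v).card + 1 ≤
      (Finset.univ.filter fun y => G.dist y v < G.dist u v).card :=
    Finset.card_lt_card ((Finset.ssubset_iff_of_subset
      (Finset.monotone_filter_right _ fun y _ hy => hy.trans hlt)).2
        ⟨x, by simpa using hlt, by simp⟩)
  calc G.dist u v = G.dist x v + G.w u x := by rw [← hx, add_comm]
    _ ≤ ((Finset.univ.filter fun y => G.dist y v < G.dist x v).card * W : ℕ) + W :=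
      add_le_add (ih _ hlt hxv rfl) (hW u x hw)
    _ = (((Finset.univ.filter fun y => G.dist y v < G.dist x v).card + 1) * W : ℕ) := by
      push_cast; ring
    _ ≤ _ := by exact_mod_cast Nat.mul_le_mul_right W hcard

theorem dist_le_card_mul [Fintype V] {W : ℕ} (hW : ∀ y z, G.w y z ≠ ⊤ → G.w y z ≤ W)
    (huv : G.dist u v ≠ ⊤) : G.dist u v ≤ (Fintype.card V * W : ℕ) := by
  classical
  exact (dist_le_card_filter_mul hW huv).trans
    (by exact_mod_cast Nat.mul_le_mul_right W (Finset.card_le_univ _))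

theorem dist_le_weightedDiam [Fintype V] {L : ℕ} (hd : G.dist u v = L) : L ≤ G.weightedDiam := by
  simpa only [hd, ENat.toNat_natCast, weightedDiam] using
    Finset.le_sup (f := fun p : V × V => (G.dist p.1 p.2).toNat) (Finset.mem_univ (u, v))

/-- `x` lies on a shortest path from `u` to `v`, provided that `v` is reachable from `u`. -/
def IsBetween (G : WDigraph V) (u x v : V) : Prop :=
  G.dist u x + G.dist x v = G.dist u v

theorem isBetween_left (G : WDigraph V) (u v : V) : G.IsBetween u u v := by
  rw [IsBetween, dist_self, zero_add]

theorem IsBetween.dist_left_ne_top (hx : G.IsBetween u x v) (huv : G.dist u v ≠ ⊤) :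
    G.dist u x ≠ ⊤ := fun h => huv (by rw [← hx, h, top_add])

theorem IsBetween.dist_right_ne_top (hx : G.IsBetween u x v) (huv : G.dist u v ≠ ⊤) :
    G.dist x v ≠ ⊤ := fun h => huv (by rw [← hx, h, add_top])

theorem IsBetween.dist_lt (hx : G.IsBetween u x v) (huv : G.dist u v ≠ ⊤) (hxv : x ≠ v) :
    G.dist u x < G.dist u v := by
  rw [← hx, add_comm]
  exact ENat.lt_add_left (hx.dist_left_ne_top huv) (G.dist_pos hxv)

theorem IsBetween.dist_eq_add_w (hy : G.IsBetween u y v) (huv : G.dist u v ≠ ⊤)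
    (hx : G.w y x + G.dist x v = G.dist y v) : G.dist u x = G.dist u y + G.w y x := by
  have h₁ := (G.dist_triangle u y x).trans (add_le_add_right (G.dist_le_w y x) _)
  have h₂ := G.dist_triangle u x v
  have hxv : G.dist x v ≠ ⊤ :=
    fun h => hy.dist_right_ne_top huv (by rw [← hx, h, add_top])
  rw [← hy, ← hx, ← add_assoc] at h₂
  exact le_antisymm h₁ ((ENat.add_le_add_iff_right hxv).1 h₂)

theorem IsBetween.step (hy : G.IsBetween u y v) (huv : G.dist u v ≠ ⊤)
    (hx : G.w y x + G.dist x v = G.dist y v) : G.IsBetween u x v := by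
  rw [IsBetween, hy.dist_eq_add_w huv hx, add_assoc, hx, hy]

end Dist

section Nearest

variable [Fintype V] [LinearOrder V] {G : WDigraph V} {k : ℕ} {u v x y : V}

theorem mem_nearest : v ∈ G.nearest k u ↔ lexRank (G.dist u) v < k := by
  simp only [nearest, lexRank, Prod.Lex.toLex_lt_toLex, Finset.mem_filter, Finset.mem_univ,
    true_and]

theorem IsBetween.mem_nearest_of_mem (hx : G.IsBetween u x v) (huv : G.dist u v ≠ ⊤)
    (hv : v ∈ G.nearest k u) : v ∈ G.nearest k x :=
  mem_nearest.2 <| (lexRank_le_of_le_strictMono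
    (fun _ _ h => (ENat.add_lt_add_iff_left (hx.dist_left_ne_top huv)).2 h)
    (G.dist_triangle u x) hx.symm).trans_lt (mem_nearest.1 hv)

theorem IsBetween.left_mem_nearest (hx : G.IsBetween u x v) (huv : G.dist u v ≠ ⊤)
    (hv : v ∈ G.nearest k u) : x ∈ G.nearest k u := by
  obtain rfl | hxv := eq_or_ne x v
  · exact hv
  · exact mem_nearest.2 ((lexRank_lt_of_lt (hx.dist_lt huv hxv)).trans (mem_nearest.1 hv))

theorem lexRank_w_lt_of_w_add_dist_eq (hv : v ∈ G.nearest k u) (huv : G.dist u v ≠ ⊤)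
    (hx : G.w u x + G.dist x v = G.dist u v) : lexRank (G.w u) x < k := by
  have hu := G.isBetween_left u v
  have hux : G.dist u x = G.w u x := by simpa using hu.dist_eq_add_w huv hx
  exact (lexRank_le_of_le_strictMono strictMono_id (G.dist_le_w u) hux).trans_lt
    (mem_nearest.1 ((hu.step huv hx).left_mem_nearest huv hv))

/-- `K` is a subgraph of `G` that contains the `k` lightest outgoing edges of the `k` nodes with the
smallest values of `f`. In the hopset algorithm `f` holds the distance estimates of a node. -/
structure IsLocalView {α : Type} [LinearOrder α] (G : WDigraph V) (k : ℕ) (f : V → α)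
    (K : WDigraph V) : Prop where
  w_le : ∀ y z, G.w y z ≤ K.w y z
  w_eq : ∀ y z, lexRank f y < k → lexRank (G.w y) z < k → K.w y z = G.w y z

theorem IsLocalView.exists_isBetween {α : Type} [LinearOrder α] {f : V → α} {K : WDigraph V}
    (hK : G.IsLocalView k f K) (hv : v ∈ G.nearest k u) (huv : G.dist u v ≠ ⊤) :
    ∃ y, G.IsBetween u y v ∧ K.dist u y = G.dist u y ∧ (y = v ∨ k ≤ lexRank f y) := by
  classical
  obtain ⟨y, hy, hmax⟩ := Finset.exists_max_image
    (Finset.univ.filter fun y => G.IsBetween u y v ∧ K.dist u y = G.dist u y) (G.dist u)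
    ⟨u, Finset.mem_filter.2 ⟨Finset.mem_univ u, G.isBetween_left u v, by rw [dist_self, dist_self]⟩⟩
  simp only [Finset.mem_filter, Finset.mem_univ, true_and, and_imp] at hy hmax
  obtain ⟨hy, hKy⟩ := hy
  refine ⟨y, hy, hKy, or_iff_not_imp_left.2 fun hyv => not_lt.1 fun hyk => ?_⟩
  obtain ⟨x, hx⟩ := G.exists_w_add_dist_eq hyv
  have hux : G.dist u x = G.dist u y + G.w y x := hy.dist_eq_add_w huv hx
  have hKw : K.w y x = G.w y x := hK.w_eq y x hyk <| lexRank_w_lt_of_w_add_dist_eq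
    (hy.mem_nearest_of_mem huv hv) (hy.dist_right_ne_top huv) hx
  have hKx : K.dist u x = G.dist u x := by
    refine le_antisymm ?_ (dist_le_dist_of_forall_w_le_w hK.w_le u x)
    calc K.dist u x ≤ K.dist u y + K.w y x :=
          (K.dist_triangle u y x).trans (add_le_add_right (K.dist_le_w y x) _)
      _ = G.dist u x := by rw [hKy, hKw, hux]
  have hlt : G.dist u y < G.dist u x := by
    rw [hux, add_comm]
    exact ENat.lt_add_left (hy.dist_left_ne_top huv) (G.pos y x)
  exact hlt.not_ge (hmax x (hy.step huv hx) hKx)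

variable {a : ℝ} {δ : V → V → ℝ≥0∞}

theorem IsApproxAPSP.dist_le_mul_of_le_lexRank (hδ : G.IsApproxAPSP a δ)
    (hv : v ∈ G.nearest k u) (hyu : y ∈ G.nearest k u) (hy : k ≤ lexRank (δ u) y) :
    ((G.dist u v : ℕ∞) : ℝ≥0∞) ≤ ENNReal.ofReal a * ((G.dist u y : ℕ∞) : ℝ≥0∞) := by
  obtain ⟨z, hz, hzy⟩ := exists_le_lexRank_of_lexRank_lt hy (mem_nearest.1 hyu)
  have hvz : G.dist u v ≤ G.dist u z :=
    not_lt.1 fun h => ((lexRank_lt_of_lt h).trans (mem_nearest.1 hv)).not_ge hz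
  calc ((G.dist u v : ℕ∞) : ℝ≥0∞) ≤ (G.dist u z : ℕ∞) := ENat.toENNReal_le.2 hvz
    _ ≤ δ u z := (hδ u z).1
    _ ≤ δ u y := hzy
    _ ≤ ENNReal.ofReal a * (G.dist u y : ℕ∞) := (hδ u y).2

theorem IsLocalView.exists_dist_le_mul {K : WDigraph V} (hK : G.IsLocalView k (δ u) K) (ha : 1 ≤ a)
    (hδ : G.IsApproxAPSP a δ) (hv : v ∈ G.nearest k u) (huv : G.dist u v ≠ ⊤) :
    ∃ y, G.IsBetween u y v ∧ K.dist u y = G.dist u y ∧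
      ((G.dist u v : ℕ∞) : ℝ≥0∞) ≤ ENNReal.ofReal a * ((G.dist u y : ℕ∞) : ℝ≥0∞) := by
  obtain ⟨y, hy, hKy, rfl | hyk⟩ := hK.exists_isBetween hv huv
  · exact ⟨y, hy, hKy, le_mul_of_one_le_left' (ENNReal.one_le_ofReal.2 ha)⟩
  · exact ⟨y, hy, hKy, hδ.dist_le_mul_of_le_lexRank hv (hy.left_mem_nearest huv hv) hyk⟩

end Nearest

section Hopset

variable [Fintype V] [LinearOrder V] {G H Γ : WDigraph V} {k : ℕ} {a : ℝ}

theorem le_mul_one_sub_div_of_le_ofReal_mul {A B : ℕ} (ha : 0 < a)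
    (h : ((A + B : ℕ) : ℝ≥0∞) ≤ ENNReal.ofReal a * A) :
    (B : ℝ) ≤ ((A + B : ℕ) : ℝ) * (1 - 1 / a) := by
  rw [← ENNReal.ofReal_natCast, ← ENNReal.ofReal_natCast, ← ENNReal.ofReal_mul ha.le,
    ENNReal.ofReal_le_ofReal_iff (by positivity), ← div_le_iff₀' ha] at h
  rw [mul_sub, mul_one, mul_one_div]
  push_cast at h ⊢
  linarith

theorem exists_isPath_le_of_forall_exists_edge (ha : 1 ≤ a)
    (hΓ : ∀ u v, v ∈ G.nearest k u → u ≠ v → G.dist u v ≠ ⊤ →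
      ∃ y, G.IsBetween u y v ∧ Γ.w u y = G.dist u y ∧
        ((G.dist u v : ℕ∞) : ℝ≥0∞) ≤ ENNReal.ofReal a * ((G.dist u y : ℕ∞) : ℝ≥0∞))
    {t L : ℕ} {u v : V} (hv : v ∈ G.nearest k u) (hL : G.dist u v = L)
    (ht : (L : ℝ) * (1 - 1 / a) ^ t < 1) : ∃ h ≤ t, Γ.IsPath u v h L := by
  have ha0 : 0 < a := by linarith
  induction t generalizing u L with
  | zero =>
    have hL0 : L < 1 := by exact_mod_cast (by simpa using ht : (L : ℝ) < 1)
    obtain rfl : L = 0 := by omega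
    obtain rfl : u = v := by_contra fun huv => (G.dist_pos huv).ne' hL
    exact ⟨0, le_rfl, IsPath.nil _⟩
  | succ t ih =>
    obtain rfl | huv := eq_or_ne u v
    · obtain rfl : L = 0 := by exact_mod_cast (hL.symm.trans (G.dist_self u))
      exact ⟨0, Nat.zero_le _, IsPath.nil _⟩
    have hfin : G.dist u v ≠ ⊤ := by simp [hL]
    obtain ⟨y, hy, hw, hle⟩ := hΓ u v hv huv hfin
    obtain ⟨A, hA⟩ := ENat.ne_top_iff_exists.1 (hy.dist_left_ne_top hfin)
    obtain ⟨B, hB⟩ := ENat.ne_top_iff_exists.1 (hy.dist_right_ne_top hfin)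
    obtain rfl : L = A + B := by
      have := hy
      rw [IsBetween, ← hA, ← hB, hL] at this
      exact_mod_cast this.symm
    have hcontract : (B : ℝ) ≤ ((A + B : ℕ) : ℝ) * (1 - 1 / a) :=
      le_mul_one_sub_div_of_le_ofReal_mul ha0 (by simpa [hL, ← hA] using hle)
    have hq : 0 ≤ 1 - 1 / a := sub_nonneg.2 ((div_le_one ha0).2 ha)
    obtain ⟨h, hh, hp⟩ := ih (hy.mem_nearest_of_mem hfin hv) hB.symm <|
      calc (B : ℝ) * (1 - 1 / a) ^ t
        _ ≤ ((A + B : ℕ) : ℝ) * (1 - 1 / a) * (1 - 1 / a) ^ t := by gcongr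
        _ = ((A + B : ℕ) : ℝ) * (1 - 1 / a) ^ (t + 1) := by ring
        _ < 1 := ht
    exact ⟨h + 1, by omega, IsPath.cons (hw.trans hA.symm) hp⟩

/-- The number of hops guaranteed by the hopset of an `a`-approximation in a graph of diameter `d`;
it is `1` for `d = 0`, where `Real.log 0 = 0`. -/
noncomputable def hopBound (a : ℝ) (d : ℕ) : ℕ := ⌊a * Real.log d⌋₊ + 1

theorem hopBound_le (ha : 0 ≤ a) (d : ℕ) : (hopBound a d : ℝ) ≤ a * Real.log d + 1 := by
  rw [hopBound, Nat.cast_add_one]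
  gcongr
  exact Nat.floor_le (mul_nonneg ha (Real.log_natCast_nonneg d))

theorem mul_one_sub_div_pow_hopBound_lt_one (ha : 1 ≤ a) {L d : ℕ} (hLd : L ≤ d) :
    (L : ℝ) * (1 - 1 / a) ^ hopBound a d < 1 := by
  obtain rfl | hL := Nat.eq_zero_or_pos L
  · simp
  have ha0 : 0 < a := by linarith
  have hd : (0 : ℝ) < d := by exact_mod_cast hL.trans_le hLd
  have hq : 0 ≤ 1 - 1 / a := sub_nonneg.2 ((div_le_one ha0).2 ha)
  have hlog : Real.log d < hopBound a d * (1 / a) := by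
    rw [mul_one_div, lt_div_iff₀' ha0, hopBound]
    exact_mod_cast Nat.lt_floor_add_one (a * Real.log d)
  calc (L : ℝ) * (1 - 1 / a) ^ hopBound a d
    _ ≤ d * Real.exp (-(1 / a)) ^ hopBound a d := by
        gcongr
        exact Real.one_sub_le_exp_neg _
    _ = d * Real.exp (-(hopBound a d * (1 / a))) := by rw [← Real.exp_nat_mul, mul_neg]
    _ < d * Real.exp (-Real.log d) := by gcongr
    _ = 1 := by rw [Real.exp_neg, Real.exp_log hd, mul_inv_cancel₀ hd.ne']

theorem isNearestHopset_of_isLocalView (ha : 1 ≤ a) {δ : V → V → ℝ≥0∞}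
    (hδ : G.IsApproxAPSP a δ) {K : V → WDigraph V} (hK : ∀ u, G.IsLocalView k (δ u) (K u))
    (hKH : ∀ u v, (K u).dist u v ≤ H.w u v)
    (hH : ∀ u v, u ≠ v → (K u).dist u v = G.dist u v → H.w u v = G.dist u v) :
    G.IsNearestHopset H k (hopBound a G.weightedDiam) := by
  have hGH : ∀ u v, G.dist u v ≤ H.w u v := fun u v =>
    (dist_le_dist_of_forall_w_le_w (hK u).w_le u v).trans (hKH u v)
  refine ⟨fun u v => le_antisymm ?_ ?_, fun u v hv L hL => ?_⟩
  · exact dist_le_dist_of_forall_w_le_w (fun _ _ => min_le_left _ _) u v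
  · exact dist_le_dist_of_forall_dist_le_w (fun y z => le_min (G.dist_le_w y z) (hGH y z)) u v
  · refine exists_isPath_le_of_forall_exists_edge ha (fun u v hv huv hfin => ?_) hv hL
      (mul_one_sub_div_pow_hopBound_lt_one ha (dist_le_weightedDiam hL))
    obtain ⟨y, hy, hKy, hle⟩ := (hK u).exists_dist_le_mul ha hδ hv hfin
    have huy : u ≠ y := by
      rintro rfl
      simp [(G.dist_pos huv).ne'] at hle
    have hHy : H.w u y = G.dist u y := hH u y huy hKy
    exact ⟨y, hy, (min_eq_right (hHy ▸ G.dist_le_w u y)).trans hHy, hle⟩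

theorem isNearestHopset_self_of_subsingleton [Subsingleton V] (G : WDigraph V) (k β : ℕ) :
    G.IsNearestHopset G k β := by
  refine ⟨fun u v => ?_, fun u v _ L hL => ⟨0, Nat.zero_le β, ?_⟩⟩
  · rw [Subsingleton.elim v u, dist_self, dist_self]
  · obtain rfl := Subsingleton.elim u v
    obtain rfl : L = 0 := by exact_mod_cast hL.symm.trans (G.dist_self u)
    exact IsPath.nil u

end Hopset

section OfEdges

variable {V ι : Type} [DecidableEq V] {src tgt : ι → V} {wt : ι → ℕ∞} {G : WDigraph V}

/-- The graph with an edge of weight `wt i` from `src i` to `tgt i` for every `i`, where of parallel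
edges the lightest one is kept. To get a graph for arbitrary lists of edges, loops are dropped and
weight `0` is raised to `1`. -/
noncomputable def ofEdges (src tgt : ι → V) (wt : ι → ℕ∞) : WDigraph V where
  w y z := if y = z then ⊤ else max 1 (⨅ i, ⨅ _ : src i = y ∧ tgt i = z, wt i)
  loopless v := by simp
  pos u v := by
    split_ifs
    · exact ENat.top_pos
    · exact lt_max_of_lt_left zero_lt_one

theorem w_le_ofEdges_w (h : ∀ i, G.w (src i) (tgt i) ≤ wt i) (y z : V) :
    G.w y z ≤ (ofEdges src tgt wt).w y z := by
  simp only [ofEdges]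
  split_ifs
  · exact le_top
  · refine le_max_of_le_right (le_iInf₂ ?_)
    rintro i ⟨rfl, rfl⟩
    exact h i

theorem ofEdges_w_eq (h : ∀ i, G.w (src i) (tgt i) ≤ wt i) {i : ι}
    (hi : wt i = G.w (src i) (tgt i)) :
    (ofEdges src tgt wt).w (src i) (tgt i) = G.w (src i) (tgt i) := by
  refine le_antisymm ?_ (w_le_ofEdges_w h _ _)
  simp only [ofEdges]
  split_ifs with hloop
  · rw [← hloop, G.loopless]
  · exact max_le (Order.one_le_iff_pos.2 (G.pos _ _)) ((iInf₂_le i ⟨rfl, rfl⟩).trans_eq hi)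

end OfEdges

end WDigraph

section TruncWeight

variable {Q : ℕ}

/-- The weight that a message stands for: messages have room for the weights below `Q` and for `⊤`,
which is encoded as `none`. -/
def weightOf : Option (Fin Q) → ℕ∞
  | none => ⊤
  | some i => (i : ℕ)

/-- The encoding of a weight in a message, which rounds weights that are at least `Q` up to `⊤`. -/
noncomputable def truncWeight (Q : ℕ) (x : ℕ∞) : Option (Fin Q) :=
  if h : x ≠ ⊤ ∧ x.toNat < Q then some ⟨x.toNat, h.2⟩ else none

theorem weightOf_truncWeight_of_lt {x : ℕ∞} (hx : x ≠ ⊤ → x < Q) :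
    weightOf (truncWeight Q x) = x := by
  by_cases h : x = ⊤
  · simp [truncWeight, weightOf, h]
  · obtain ⟨m, rfl⟩ := ENat.ne_top_iff_exists.1 h
    have hm : m < Q := by exact_mod_cast hx h
    simp [truncWeight, weightOf, hm]

theorem le_weightOf_truncWeight (x : ℕ∞) : x ≤ weightOf (truncWeight Q x) := by
  by_cases h : x ≠ ⊤ ∧ x.toNat < Q
  · simp [truncWeight, weightOf, h, ENat.natCast_toNat h.1]
  · simp [truncWeight, weightOf, h]

end TruncWeight

namespace CliqueAlg

variable {n B : ℕ} {I O M : Type} [Inhabited M]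

/-- The histories of all nodes after a number of rounds in which `send r u i h v` is the message of
type `M` that `u`, with input `i` and history `h`, sends to `v` in round `r`. The history of a node
lists the messages received from each node in each past round; future rounds hold `default`. -/
def history (send : ℕ → Fin n → I → (ℕ → Fin n → M) → Fin n → M) (inp : Fin n → I) :
    ℕ → Fin n → ℕ → Fin n → M
  | 0, _ => default
  | r + 1, v => Function.update (history send inp r v) r fun u =>
      send r u (inp u) (history send inp r u) v

/-- The algorithm in which every node remembers its input and its history, see
`CliqueAlg.history`, and in which messages of type `M` are encoded into `B` bits by `enc`. -/
noncomputable def ofHistory (enc : M ↪ (Fin B → Bool))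
    (send : ℕ → Fin n → I → (ℕ → Fin n → M) → Fin n → M)
    (output : Fin n → I → (ℕ → Fin n → M) → O) : CliqueAlg n B I O where
  State := I × (ℕ → Fin n → M)
  init _ i := (i, default)
  send r u s v := enc (send r u s.1 s.2 v)
  step r _ s m := (s.1, Function.update s.2 r fun u => Function.invFun enc (m u))
  output v s := output v s.1 s.2

variable (enc : M ↪ (Fin B → Bool)) (send : ℕ → Fin n → I → (ℕ → Fin n → M) → Fin n → M)
  (output : Fin n → I → (ℕ → Fin n → M) → O) (inp : Fin n → I)

theorem stateAt_ofHistory (r : ℕ) (v : Fin n) :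
    (ofHistory enc send output).stateAt inp r v = (inp v, history send inp r v) := by
  induction r generalizing v with
  | zero => rfl
  | succ r ih =>
    rw [stateAt, history]
    simp only [ih]
    simp only [ofHistory, Function.leftInverse_invFun enc.injective _]

theorem run_ofHistory (r : ℕ) (v : Fin n) :
    (ofHistory enc send output).run r inp v = output v (inp v) (history send inp r v) := by
  rw [run, stateAt_ofHistory]
  rfl

end CliqueAlg

namespace NearestHopset

variable {n s Q : ℕ}

/-- A message: in each of `s` slots, the target of an edge and its encoded weight. -/
abbrev Msg (n s Q : ℕ) : Type := Fin s → Fin n × Option (Fin Q)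

/-- The pair `(i, j)` that slot `c` of node `x` is in charge of, for `q = (x, c)`: it handles edge
number `i` of every node `y`, on behalf of the nodes that have `y` in position `j` of their list of
nearest nodes. Every pair of numbers below `k` occurs if there are at least `k * k` slots. -/
def slot (k : ℕ) (q : Fin n × Fin s) : ℕ × ℕ :=
  ((finProdFinEquiv q : ℕ) / k, (finProdFinEquiv q : ℕ) % k)

theorem exists_slot_eq {k i j : ℕ} (hk : k * k ≤ n * s) (hi : i < k) (hj : j < k) :
    ∃ q : Fin n × Fin s, slot k q = (i, j) := by
  have hlt : j + k * i < n * s := by nlinarith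
  refine ⟨finProdFinEquiv.symm ⟨j + k * i, hlt⟩, ?_⟩
  rw [slot, Equiv.apply_symm_apply, Prod.mk.injEq]
  exact ⟨by rw [Nat.add_mul_div_left _ _ (by omega), Nat.div_eq_of_lt hj, zero_add],
    by rw [Nat.add_mul_mod_self_left, Nat.mod_eq_of_lt hj]⟩

variable [NeZero n]

/-- The graph of the edges that a node with estimates `f` learns from the replies `m`. -/
noncomputable def localGraph (k : ℕ) (f : Fin n → ℝ≥0∞) (m : Fin n → Msg n s Q) :
    WDigraph (Fin n) :=
  WDigraph.ofEdges (fun q : Fin n × Fin s => atLexRank f (slot k q).2) (fun q => (m q.1 q.2).1)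
    fun q => weightOf (m q.1 q.2).2

/-- The encoded weight of the hopset edge from `u` to `v`, where `u` has estimates `f` and received
the replies `m`. -/
noncomputable def hopsetEdge (k : ℕ) (f : Fin n → ℝ≥0∞) (m : Fin n → Msg n s Q) (u v : Fin n) :
    Option (Fin Q) :=
  truncWeight Q (if u = v then ⊤ else (localGraph k f m).dist u v)

/-- The messages of the hopset algorithm.
Round 0: every node hands out its lightest outgoing edges to the slots.
Round 1: every node asks the slots for the edges of the nodes that look nearest to it.
Round 2: the slots reply with what they received in round 0.
Round 3: every node announces its outgoing hopset edges. -/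
noncomputable def send (k : ℕ) : ℕ → Fin n → IncidentEdges n × (Fin n → ℝ≥0∞) →
    (ℕ → Fin n → Msg n s Q) → Fin n → Msg n s Q
  | 0, _, i, _, x => fun c =>
      let z := atLexRank i.1.outW (slot k (x, c)).1
      (z, truncWeight Q (i.1.outW z))
  | 1, _, i, _, x => fun c => (atLexRank i.2 (slot k (x, c)).2, none)
  | 2, _, _, hist, u => fun c => hist 0 (hist 1 u c).1 c
  | _ + 3, u, i, hist, v => fun _ => (v, hopsetEdge k i.2 (hist 2) u v)

/-- The local output of the hopset algorithm. -/
noncomputable def output [NeZero s] (k : ℕ) (v : Fin n) (i : IncidentEdges n × (Fin n → ℝ≥0∞))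
    (hist : ℕ → Fin n → Msg n s Q) : IncidentEdges n where
  outW x := weightOf (hopsetEdge k i.2 (hist 2) v x)
  inW x := weightOf (hist 3 x 0).2

/-- The replies that a node with estimates `f` receives in round 2. -/
noncomputable def replies (k : ℕ) (G : WDigraph (Fin n)) (f : Fin n → ℝ≥0∞) (x : Fin n) :
    Msg n s Q := fun c =>
  let y := atLexRank f (slot k (x, c)).2
  let z := atLexRank (G.w y) (slot k (x, c)).1
  (z, truncWeight Q (G.w y z))

theorem isLocalView_localGraph {k : ℕ} (hk : k * k ≤ n * s) {G : WDigraph (Fin n)}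
    (hQ : ∀ y z, G.w y z ≠ ⊤ → G.w y z < Q) (f : Fin n → ℝ≥0∞) :
    G.IsLocalView k f (localGraph k f (replies (s := s) (Q := Q) k G f)) where
  w_le := WDigraph.w_le_ofEdges_w fun _ => le_weightOf_truncWeight _
  w_eq y z hy hz := by
    obtain ⟨q, hq⟩ := exists_slot_eq hk hz hy
    have h := WDigraph.ofEdges_w_eq (G := G) (src := fun q => atLexRank f (slot k q).2)
      (tgt := fun q => (replies (s := s) (Q := Q) k G f q.1 q.2).1)
      (wt := fun q => weightOf (replies (s := s) (Q := Q) k G f q.1 q.2).2)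
      (fun _ => le_weightOf_truncWeight _) (i := q) (weightOf_truncWeight_of_lt (hQ _ _))
    simpa only [localGraph, replies, hq, atLexRank_lexRank] using h

/-- The graph that the algorithm computes. -/
noncomputable def hopset (k s Q : ℕ) (G : WDigraph (Fin n)) (δ : Fin n → Fin n → ℝ≥0∞) :
    WDigraph (Fin n) where
  w u v := weightOf (hopsetEdge k (δ u) (replies (s := s) (Q := Q) k G (δ u)) u v)
  loopless v := by simp [hopsetEdge, truncWeight, weightOf]
  pos u v := by
    refine lt_of_lt_of_le ?_ (le_weightOf_truncWeight _)
    split_ifs with huv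
    · exact ENat.top_pos
    · exact WDigraph.dist_pos _ huv

theorem output_history [NeZero s] (k : ℕ) (G : WDigraph (Fin n)) (δ : Fin n → Fin n → ℝ≥0∞)
    (v : Fin n) :
    output k v (G.incident v, δ v)
      (CliqueAlg.history (send (s := s) (Q := Q) k) (fun x => (G.incident x, δ x)) 4 v) =
      (hopset k s Q G δ).incident v :=
  rfl

theorem isNearestHopset_hopset {k W : ℕ} (hk : k * k ≤ n * s) (hQ : n * W < Q)
    {G : WDigraph (Fin n)} (hW : ∀ u v, G.w u v ≠ ⊤ → G.w u v ≤ W) {a : ℝ} (ha : 1 ≤ a)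
    {δ : Fin n → Fin n → ℝ≥0∞} (hδ : G.IsApproxAPSP a δ) :
    G.IsNearestHopset (hopset k s Q G δ) k (WDigraph.hopBound a G.weightedDiam) := by
  have hw_lt : ∀ u v, G.w u v ≠ ⊤ → G.w u v < Q := fun u v huv =>
    (hW u v huv).trans_lt (by exact_mod_cast (Nat.le_mul_of_pos_left W (NeZero.pos n)).trans_lt hQ)
  have hdist_lt : ∀ u v, G.dist u v ≠ ⊤ → G.dist u v < Q := fun u v huv =>
    (WDigraph.dist_le_card_mul hW huv).trans_lt (by simpa using (by exact_mod_cast hQ))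
  refine WDigraph.isNearestHopset_of_isLocalView ha hδ
    (fun u => isLocalView_localGraph hk hw_lt (δ u)) (fun u v => ?_) (fun u v huv hd => ?_)
  · refine le_trans ?_ (le_weightOf_truncWeight _)
    split_ifs
    · exact le_top
    · exact le_rfl
  · simp only [hopset, hopsetEdge, if_neg huv, hd]
    exact weightOf_truncWeight_of_lt (hdist_lt u v)

theorem exists_cliqueAlg [NeZero s] {k W B : ℕ} (hk : k * k ≤ n * s)
    (hB : (n * (n * W + 2)) ^ s ≤ 2 ^ B) :
    ∃ A : CliqueAlg n B (IncidentEdges n × (Fin n → ℝ≥0∞)) (IncidentEdges n),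
      ∀ (G : WDigraph (Fin n)) (a : ℝ) (δ : Fin n → Fin n → ℝ≥0∞),
        (∀ u v, G.w u v ≠ ⊤ → G.w u v ≤ W) → 1 ≤ a → G.IsApproxAPSP a δ →
        ∃ H : WDigraph (Fin n),
          (∀ v, A.run 4 (fun x => (G.incident x, δ x)) v = H.incident v) ∧
          G.IsNearestHopset H k (WDigraph.hopBound a G.weightedDiam) := by
  obtain ⟨enc⟩ : Nonempty (Msg n s (n * W + 1) ↪ (Fin B → Bool)) :=
    Function.Embedding.nonempty_of_card_le (by simpa using hB)
  exact ⟨CliqueAlg.ofHistory enc (send k) (output k), fun G a δ hW ha hδ =>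
    ⟨hopset k s (n * W + 1) G δ,
      fun v => (CliqueAlg.run_ofHistory ..).trans (output_history k G δ v),
      isNearestHopset_hopset hk (Nat.lt_succ_self _) hW ha hδ⟩⟩

end NearestHopset

theorem ceil_sqrt_mul_self_le (n : ℕ) : ⌈√(n : ℝ)⌉₊ * ⌈√(n : ℝ)⌉₊ ≤ n * 4 := by
  obtain rfl | hn := Nat.eq_zero_or_pos n
  · simp
  have hsqrt : (1 : ℝ) ≤ √n := Real.one_le_sqrt.2 (by exact_mod_cast hn)
  have hceil : (⌈√(n : ℝ)⌉₊ : ℝ) ≤ 2 * √n := Nat.ceil_le_two_mul (by linarith)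
  have hsq : (⌈√(n : ℝ)⌉₊ : ℝ) * ⌈√(n : ℝ)⌉₊ ≤ n * 4 :=
    calc (⌈√(n : ℝ)⌉₊ : ℝ) * ⌈√(n : ℝ)⌉₊ ≤ (2 * √n) * (2 * √n) := by gcongr
      _ = √n * √n * 4 := by ring
      _ = n * 4 := by rw [Real.mul_self_sqrt (Nat.cast_nonneg n)]
  exact_mod_cast hsq

theorem mul_mul_pow_add_two_pow_le {n : ℕ} (hn : 2 ≤ n) (p s : ℕ) :
    (n * (n * n ^ p + 2)) ^ s ≤ 2 ^ (s * (p + 3) * Nat.clog 2 n) := by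
  have htwo : 2 ≤ n * n ^ p := hn.trans (Nat.le_mul_of_pos_right n (by positivity))
  calc (n * (n * n ^ p + 2)) ^ s ≤ (n * (n * (n * n ^ p))) ^ s := by gcongr; nlinarith
    _ = n ^ (s * (p + 3)) := by ring
    _ ≤ (2 ^ Nat.clog 2 n) ^ (s * (p + 3)) := by gcongr; exact Nat.le_pow_clog one_lt_two n
    _ = 2 ^ (s * (p + 3) * Nat.clog 2 n) := by rw [← pow_mul, mul_comm]

theorem lemma3p2 :
    ∃ (C : ℝ) (R : ℕ), ∀ p : ℕ, ∃ c : ℕ, ∀ n : ℕ,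
      ∃ A : CliqueAlg n (c * Nat.clog 2 n) (IncidentEdges n × (Fin n → ℝ≥0∞)) (IncidentEdges n),
        ∀ (G : WDigraph (Fin n)) (a : ℝ) (δ : Fin n → Fin n → ℝ≥0∞),
          (∀ u v, G.w u v ≠ ⊤ → G.w u v ≤ ((n ^ p : ℕ) : ℕ∞)) →
          1 ≤ a → G.IsApproxAPSP a δ →
          ∃ (H : WDigraph (Fin n)) (β : ℕ),
            (∀ v, A.run R (fun x => (G.incident x, δ x)) v = H.incident v) ∧
            (β : ℝ) ≤ C * (a * Real.log (G.weightedDiam : ℝ) + 1) ∧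
            G.IsNearestHopset H ⌈Real.sqrt (n : ℝ)⌉₊ β := by
  refine ⟨1, 4, fun p => ⟨4 * (p + 3), fun n => ?_⟩⟩
  rcases Nat.lt_or_ge n 2 with hn | hn
  · -- Messages have no bits here, but there are no edges either, and the input is returned.
    have : Subsingleton (Fin n) := Fin.subsingleton_iff_le_one.2 (by omega)
    refine ⟨⟨IncidentEdges n, fun _ i => i.1, fun _ _ _ _ _ => false, fun _ _ s _ => s,
      fun _ s => s⟩, fun G a δ _ ha _ => ⟨G, 0, fun v => rfl, ?_,
        G.isNearestHopset_self_of_subsingleton _ 0⟩⟩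
    have := Real.log_natCast_nonneg G.weightedDiam
    push_cast
    positivity
  · have : NeZero n := ⟨by omega⟩
    obtain ⟨A, hA⟩ := NearestHopset.exists_cliqueAlg (ceil_sqrt_mul_self_le n)
      (mul_mul_pow_add_two_pow_le hn p 4)
    refine ⟨A, fun G a δ hW ha hδ => ?_⟩
    obtain ⟨H, hrun, hH⟩ := hA G a δ hW ha hδ
    refine ⟨H, WDigraph.hopBound a G.weightedDiam, hrun, ?_, hH⟩
    rw [one_mul]
    exact WDigraph.hopBound_le (zero_le_one.trans ha) _
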